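/- A Gelfand–Tsetlin triangle of size $n$ is an array $X=(X_{i,j})_{n\ge i\ge j\ge 1}$ of positive integers with $X_{i+1,j}\le X_{i,j}\le X_{i+1,j+1}$ for $n-1\ge i\ge j\ge 1$. It is a *Gog triangle* if $X_{i,j}<X_{i,j+1}$ for $1\le j<i\le n-1$ and $X_{n,j}=j$ for $1\le j\le n$; it is a *Magog triangle* if $X_{j,j}\le j$ for $1\le j\le n$; it is a *GOGAm triangle* if its image under the Schützenberger involution $S$ is a Magog triangle. Here $S=\omega_1\omega_2\cdots\omega_{n-1}$, $\omega_j=s_js_{j-1}\cdots s_1$, and $s_k$ changes only row $k$, replacing $X_{k,j}$ by $\max(X_{k+1,j},X_{k-1,j-1})+\min(X_{k+1,j+1},X_{k-1,j})-X_{k,j}$, where entries that do not exist are omitted from the maximum or minimum. For $n\ge k,l,m$, an $(n,k,l,m)$ Gog (resp. GOGAm) pentagon is the array of the entries $X_{i,j}$ with $j\le k$, $i-j\le l-1$, $i\le m$ of some Gog (resp. GOGAm) triangle $X$ of size $n$. An *inversion* of a triangle $X$ of size $N$ is a pair $(i,j)$, $1\le j\le i\le N-1$, with $X_{i,j}=X_{i+1,j}$;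 it covers the positions $(i+p,j+p)$, $1\le p\le N-i$. The *standard procedure* goes through the inversions $(i,j)$ of $X$ in the order of decreasing $j$ and, for equal $j$, of decreasing $i$, and for each of them subtracts $1$ from all entries it covers; $X$ is *admissible* if all the successive arrays so obtained are Gelfand–Tsetlin triangles. Let $n\ge 3$. Write a size-$3$ triangle as $(a,d,f\,|\,b,e\,|\,c)$, with $a=X_{3,1}$, $d=X_{3,2}$, $f=X_{3,3}$, $b=X_{2,1}$, $e=X_{2,2}$, $c=X_{1,1}$. 1. The $(n,3,3,3)$ Gog pentagons are exactly the Gelfand–Tsetlin triangles of size $3$ with $a<d<f$, $b<e$, $f\le n$. 2. The $(n,3,3,3)$ GOGAm pentagons are exactly the Gelfand–Tsetlin triangles of size $3$ with $f\le n$, $f-e+d\le n-1$, $f-c+b\le n-1$, $f-e+d-b+a\le n-2$. 3. The following table, which lists the $(n,3,3,3)$ Gog pentagons by their set of inversions, defines a bijection from the $(n,3,3,3)$ Gog pentagons onto the $(n,3,3,3)$ GOGAm pentagons: | inversions | Gog | GOGAm | |---|---|---| | none | $(a,d,f\,\vert\,b,e\,\vert\,c)$ | $(a,d,f\,\vert\,b,e\,\vert\,c)$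 | | $(2,2)$ | $(a,d,f\,\vert\,b,d\,\vert\,c)$ | $(a,d,f-1\,\vert\,b,d\,\vert\,c)$ | | $(2,1)$ | $(a,d,f\,\vert\,a,e\,\vert\,c)$ | $(a,d-1,f\,\vert\,a,e\,\vert\,c)$ | | $(1,1)$ | $(a,d,f\,\vert\,b,e\,\vert\,b)$ | $(a,d,f-1\,\vert\,b,e-1\,\vert\,b)$ | | $(1,1),(2,2)$ | $(a,d,f\,\vert\,b,d\,\vert\,b)$ | $(a,d-1,f-2\,\vert\,a,d-1\,\vert\,b)$ | | $(2,1),(2,2)$ | $(a,d,f\,\vert\,a,d\,\vert\,c)$ | $(a,d-1,f-1\,\vert\,a,d\,\vert\,c)$ | | $(2,1),(1,1)$ | $(a,d,f\,\vert\,a,e\,\vert\,a)$ | $(a,d-1,f-1\,\vert\,a,e-1\,\vert\,a)$ | | all three | $(a,d,f\,\vert\,a,d\,\vert\,a)$ | $(a,d-1,f-2\,\vert\,a,d-1\,\vert\,a)$ | 4. A Gog pentagon whose set of inversions is not $\{(1,1),(2,2)\}$ is admissible (as a triangle of size $3$), and its image in the table is the result of the standard procedure. A Gog pentagon whose set of inversions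 is $\{(1,1),(2,2)\}$ is not admissible. 5. Consequently, the sets of $(n,3,3,3)$ Gog pentagons and of $(n,3,3,3)$ GOGAm pentagons are finite and have the same number of elements. -/

import Mathlib

namespace Pentagons

/-- Arrays `(X_{i,j})` of integers. An array indexed by a finite set of positions is represented by
the function that has the given entries and is `0` at all other positions. -/
abbrev IntArray := ℕ → ℕ → ℤ

/-- Gelfand-Tsetlin triangles of size `n`: triangular arrays `(X_{i,j})`, `n ≥ i ≥ j ≥ 1`, of
positive integers (row `n`, the longest one, is drawn on top) with the interlacing inequalities. -/
def IsGelfandTsetlin (n : ℕ) (X : IntArray) : Prop :=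
  (∀ i j, 1 ≤ j → j ≤ i → i ≤ n → 0 < X i j) ∧
  (∀ i j, ¬ (1 ≤ j ∧ j ≤ i ∧ i ≤ n) → X i j = 0) ∧
  (∀ i j, 1 ≤ j → j ≤ i → i + 1 ≤ n → X (i + 1) j ≤ X i j ∧ X i j ≤ X (i + 1) (j + 1))

/-- The operation `s_k`: every entry of row `k` is reflected in the centre of the smallest interval
cut out by its neighbours in rows `k + 1` and `k - 1`. Of the latter, `X_{k-1,j-1}` is missing for
`j = 1` and `X_{k-1,j}` is missing for `j = k`. -/
def rowReflection (k : ℕ) (X : IntArray) : IntArray := fun i j =>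
  if i = k ∧ 1 ≤ j ∧ j ≤ k then
    (if 1 < j then max (X (k + 1) j) (X (k - 1) (j - 1)) else X (k + 1) j)
      + (if j < k then min (X (k + 1) (j + 1)) (X (k - 1) j) else X (k + 1) (j + 1))
      - X k j
  else X i j

/-- `ω_j = s_j s_{j-1} ⋯ s_1` (composition of maps, so `s_1` is applied first). -/
def omegaOp : ℕ → IntArray → IntArray
  | 0 => id
  | j + 1 => rowReflection (j + 1) ∘ omegaOp j

/-- `ω_1 ω_2 ⋯ ω_m` (composition of maps). -/
def omegaProd : ℕ → IntArray → IntArray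
  | 0 => id
  | m + 1 => omegaProd m ∘ omegaOp (m + 1)

/-- The Schützenberger involution `S = ω_1 ω_2 ⋯ ω_{n-1}` on Gelfand-Tsetlin triangles of
size `n`. -/
def schutzenberger (n : ℕ) : IntArray → IntArray := omegaProd (n - 1)

def IsGog (n : ℕ) (X : IntArray) : Prop :=
  IsGelfandTsetlin n X ∧
  (∀ i j, 1 ≤ j → j < i → i < n → X i j < X i (j + 1)) ∧
  (∀ j, 1 ≤ j → j ≤ n → X n j = (j : ℤ))

def IsMagog (n : ℕ) (X : IntArray) : Prop :=
  IsGelfandTsetlin n X ∧ ∀ j, 1 ≤ j → j ≤ n → X j j ≤ (j : ℤ)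

def IsGOGAm (n : ℕ) (X : IntArray) : Prop :=
  IsGelfandTsetlin n X ∧ IsMagog n (schutzenberger n X)

/-- The part of a triangle of size `n` in the `k` leftmost NW-SE diagonals (`j ≤ k`), the `l`
rightmost SW-NE diagonals (`i - j ≤ l - 1`) and the `m` bottom rows (`i ≤ m`). -/
def pentagonPart (n k l m : ℕ) (X : IntArray) : IntArray := fun i j =>
  if (1 ≤ j ∧ j ≤ i ∧ i ≤ n) ∧ j ≤ k ∧ i + 1 ≤ j + l ∧ i ≤ m then X i j else 0

/-- The set of `(n,k,l,m)` Gog pentagons (for `n ≥ k, l, m`). -/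
def gogPentagons (n k l m : ℕ) : Set IntArray :=
  {P | ∃ X, IsGog n X ∧ pentagonPart n k l m X = P}

/-- The set of `(n,k,l,m)` GOGAm pentagons (for `n ≥ k, l, m`). -/
def gogamPentagons (n k l m : ℕ) : Set IntArray :=
  {P | ∃ X, IsGOGAm n X ∧ pentagonPart n k l m X = P}

/-- `(i,j)` is an inversion of the triangle `X` of size `n`. -/
def IsInversion (n : ℕ) (X : IntArray) (i j : ℕ) : Prop :=
  (1 ≤ j ∧ j ≤ i ∧ i + 1 ≤ n) ∧ X i j = X (i + 1) j

instance (n : ℕ) (X : IntArray) (i j : ℕ) : Decidable (IsInversion n X i j) :=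
  inferInstanceAs (Decidable ((1 ≤ j ∧ j ≤ i ∧ i + 1 ≤ n) ∧ X i j = X (i + 1) j))

/-- The position `q` (in a triangle of size `n`) is covered by an inversion at position `p`. -/
def Covers (n : ℕ) (p q : ℕ × ℕ) : Prop :=
  ∃ t : ℕ, 1 ≤ t ∧ p.1 + t ≤ n ∧ q = (p.1 + t, p.2 + t)

open Classical in
/-- Subtract `1` from all entries covered by the inversion at position `p`. -/
noncomputable def subtractCovered (n : ℕ) (X : IntArray) (p : ℕ × ℕ) : IntArray := fun i j =>
  if Covers n p (i, j) then X i j - 1 else X i j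

/-- The inversions of a triangle of size `n`, listed along the successive NW-SE diagonals
(`j` constant), starting from the rightmost one (largest `j`), and along each diagonal from NW to SE
(decreasing `i`). -/
def inversionList (n : ℕ) (X : IntArray) : List (ℕ × ℕ) :=
  ((List.range n).reverse.flatMap fun j => (List.range n).reverse.map fun i => (i, j)).filter
    fun p => decide (IsInversion n X p.1 p.2)

/-- The result of the standard procedure: for each inversion of `X`, in the order of
`inversionList`, subtract `1` from the entries that it covers. -/
noncomputable def standardProcedure (n : ℕ) (X : IntArray) : IntArray :=
  (inversionList n X).foldl (subtractCovered n) X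

/-- `X` is admissible: all the successive arrays of the standard procedure are Gelfand-Tsetlin
triangles. -/
def Admissible (n : ℕ) (X : IntArray) : Prop :=
  ∀ Y ∈ (inversionList n X).scanl (subtractCovered n) X, IsGelfandTsetlin n Y

/-- The size 3 triangle with rows, from top to bottom, `(a, d, f)`, `(b, e)`, `(c)`. -/
def triangle3 (a d f b e c : ℤ) : IntArray
  | 3, 1 => a
  | 3, 2 => d
  | 3, 3 => f
  | 2, 1 => b
  | 2, 2 => e
  | 1, 1 => c
  | _, _ => 0

/-- The explicit table. With the entries of `X` named as in `triangle3`, the three Booleans say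
whether `(2,1)` (`b = a`), `(2,2)` (`e = d`) and `(1,1)` (`c = b`) are inversions. -/
def pentagonTable (X : IntArray) : IntArray :=
  let a := X 3 1
  let d := X 3 2
  let f := X 3 3
  let b := X 2 1
  let e := X 2 2
  let c := X 1 1
  match decide (IsInversion 3 X 2 1), decide (IsInversion 3 X 2 2),
      decide (IsInversion 3 X 1 1) with
  | false, false, false => triangle3 a d f b e c
  | false, true, false => triangle3 a d (f - 1) b d c
  | true, false, false => triangle3 a (d - 1) f a e c
  | false, false, true => triangle3 a d (f - 1) b (e - 1) b
  | false, true, true => triangle3 a (d - 1) (f - 2) a (d - 1) b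
  | true, true, false => triangle3 a (d - 1) (f - 1) a d c
  | true, false, true => triangle3 a (d - 1) (f - 1) a (e - 1) a
  | true, true, true => triangle3 a (d - 1) (f - 2) a (d - 1) a

end Pentagons

open Pentagons

/-! A size-3 triangle is a pentagon exactly when it extends upwards to a full Gog or GOGAm triangle,
so each description needs necessary inequalities and one explicit extension (`extendTriangle3`). For
Gog triangles the inequalities are immediate, and the extension takes entries at least `j` on
diagonal `j`, as small as possible.

For GOGAm triangles only the corners `(j, j)` of `S X` are constrained. The factor `ω_{n-1}` acts
first and settles row `n-1`, then `ω_{n-2}` settles row `n-2`, and so on. Following the reflections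
along the last diagonal gives the lower bound `le_omegaOp_diag`, hence `f-e+d` and `f-c+b` in row
`n-1` and `f-e+d-b+a` in row `n-2`. Conversely, fill the remaining diagonals with ones: each `ω`
then removes one of the three diagonals `a, d, f` (`omegaOp_of_three_diagonals`,
`omegaOp_of_two_diagonals`, `omegaOp_diag_of_one_diagonal`), the bounds are attained, and all lower
corners equal 1.

The bijection is then linear arithmetic: the equalities `b = a`, `c = b`, `e = d`, `e = d + 1` in an
image reveal its table line. The exceptional line fills the region `b = a < c`, `e = d`, which the
other seven lines miss. -/

namespace Pentagons

/-! ### Row reflections and the Schützenberger involution -/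

lemma rowReflection_of_ne {k i : ℕ} (h : i ≠ k) (X : IntArray) (j : ℕ) :
    rowReflection k X i j = X i j := by
  simp [rowReflection, h]

/-- Interlacing says that each entry of row `k` lies in the interval cut out by its neighbours, and
reflection in the centre preserves that interval. The bounds from row `k - 1` are conditional
because those neighbours are missing at the ends. -/
lemma IsGelfandTsetlin.rowReflection {n k : ℕ} {X : IntArray} (hX : IsGelfandTsetlin n X)
    (hkn : k < n) : IsGelfandTsetlin n (rowReflection k X) := by
  obtain ⟨hpos, hzero, hint⟩ := hX
  refine ⟨fun i j h1 h2 h3 => ?_, fun i j h => ?_, fun i j h1 h2 h3 => ?_⟩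
  · by_cases hi : i = k
    · subst hi
      have := hint i j h1 h2 hkn
      have := hpos (i + 1) j h1 (h2.trans (Nat.le_succ i)) hkn
      have h4 : 1 < j → X i j ≥ X (i - 1) (j - 1) := fun hj => by
        have := (hint (i - 1) (j - 1) (by omega) (by omega) (by omega)).2
        rwa [Nat.sub_add_cancel (by omega), Nat.sub_add_cancel (by omega)] at this
      have h5 : j < i → X i j ≤ X (i - 1) j := fun hj => by
        have := (hint (i - 1) j (by omega) (by omega) (by omega)).1
        rwa [Nat.sub_add_cancel (by omega)] at this
      simp only [Pentagons.rowReflection, h1, h2, and_self, if_true]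
      split_ifs <;> omega
    · rw [rowReflection_of_ne hi]
      exact hpos i j h1 h2 h3
  · by_cases hi : i = k
    · subst hi
      have h' : ¬ (1 ≤ j ∧ j ≤ i) := fun h' => h ⟨h'.1, h'.2, by omega⟩
      simp only [Pentagons.rowReflection, h', and_false, if_false]
      exact hzero i j h
    · rw [rowReflection_of_ne hi]
      exact hzero i j h
  · by_cases hi : i = k
    · subst hi
      rw [rowReflection_of_ne (k := i) (i := i + 1) (by omega),
        rowReflection_of_ne (k := i) (i := i + 1) (by omega)]
      have := hint i j h1 h2 h3
      have h4 : 1 < j → X i j ≥ X (i - 1) (j - 1) := fun hj => by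
        have := (hint (i - 1) (j - 1) (by omega) (by omega) (by omega)).2
        rwa [Nat.sub_add_cancel (by omega), Nat.sub_add_cancel (by omega)] at this
      have h5 : j < i → X i j ≤ X (i - 1) j := fun hj => by
        have := (hint (i - 1) j (by omega) (by omega) (by omega)).1
        rwa [Nat.sub_add_cancel (by omega)] at this
      simp only [Pentagons.rowReflection, h1, h2, and_self, if_true]
      split_ifs <;> omega
    · by_cases hi' : i + 1 = k
      · subst hi'
        rw [rowReflection_of_ne hi]
        have e1 := hint (i + 1) j h1 (by omega) hkn
        have e2 := hint (i + 1) (j + 1) (by omega) (by omega) hkn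
        have e3 := hint i j h1 h2 h3
        have h4 : 1 < j → X (i + 1) j ≥ X i (j - 1) := fun hj => by
          have := (hint i (j - 1) (by omega) (by omega) (by omega)).2
          rwa [Nat.sub_add_cancel (by omega)] at this
        have h5 : j + 1 < i + 1 → X (i + 1) (j + 1) ≤ X i (j + 1) := fun hj =>
          (hint i (j + 1) (by omega) (by omega) (by omega)).1
        simp only [Pentagons.rowReflection, h1, Nat.add_sub_cancel, true_and,
          show j ≤ i + 1 by omega, show j < i + 1 by omega, show 1 ≤ j + 1 by omega,
          show j + 1 ≤ i + 1 by omega, show 1 < j + 1 by omega, if_true]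
        split_ifs <;> omega
      · rw [rowReflection_of_ne hi, rowReflection_of_ne hi', rowReflection_of_ne hi']
        exact hint i j h1 h2 h3

lemma IsGelfandTsetlin.omegaOp {n : ℕ} {X : IntArray} (hX : IsGelfandTsetlin n X) :
    ∀ {m : ℕ}, m < n → IsGelfandTsetlin n (omegaOp m X)
  | 0, _ => hX
  | m + 1, h => (IsGelfandTsetlin.omegaOp hX (by omega : m < n)).rowReflection h

lemma IsGelfandTsetlin.omegaProd {n m : ℕ} {X : IntArray} (hX : IsGelfandTsetlin n X)
    (h : m < n) : IsGelfandTsetlin n (omegaProd m X) := by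
  induction m generalizing X with
  | zero => exact hX
  | succ m ih => exact ih (hX.omegaOp h) (by omega)

lemma IsGelfandTsetlin.diag_mono {n : ℕ} {X : IntArray} (hX : IsGelfandTsetlin n X) {i k : ℕ}
    (hi : 1 ≤ i) (hik : i ≤ k) (hk : k ≤ n) : X i i ≤ X k k := by
  induction k, hik using Nat.le_induction with
  | base => exact le_rfl
  | succ k hik ih => exact (ih (by omega)).trans (hX.2.2 k k (by omega) le_rfl hk).2

lemma omegaOp_of_lt (X : IntArray) {i j : ℕ} : ∀ {m : ℕ}, m < i → omegaOp m X i j = X i j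
  | 0, _ => rfl
  | m + 1, h => by
    rw [omegaOp, Function.comp_apply, rowReflection_of_ne (by omega), omegaOp_of_lt X (by omega)]

lemma omegaOp_of_le (X : IntArray) {i j m : ℕ} (h : i ≤ m) :
    omegaOp m X i j = omegaOp i X i j := by
  induction m, h using Nat.le_induction with
  | base => rfl
  | succ m hm ih => rw [omegaOp, Function.comp_apply, rowReflection_of_ne (by omega), ih]

lemma omegaProd_of_lt {i j : ℕ} : ∀ {m : ℕ} (X : IntArray), m < i → omegaProd m X i j = X i j
  | 0, _, _ => rfl
  | m + 1, X, h => by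
    rw [omegaProd, Function.comp_apply, omegaProd_of_lt _ (by omega), omegaOp_of_lt _ h]

/-- The recursion for the entries of `ω_m X`, along the rows. -/
lemma omegaOp_succ_apply (X : IntArray) {m j : ℕ} (h1 : 1 ≤ j) (h2 : j ≤ m + 1) :
    omegaOp (m + 1) X (m + 1) j =
      (if 1 < j then max (X (m + 2) j) (omegaOp m X m (j - 1)) else X (m + 2) j)
      + (if j < m + 1 then min (X (m + 2) (j + 1)) (omegaOp m X m j) else X (m + 2) (j + 1))
      - X (m + 1) j := by
  rw [omegaOp, Function.comp_apply, rowReflection]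
  simp only [h1, h2, and_self, if_true, Nat.add_sub_cancel]
  rw [omegaOp_of_lt X (by omega : m < m + 1 + 1), omegaOp_of_lt X (by omega : m < m + 1 + 1),
    omegaOp_of_lt X (by omega : m < m + 1)]

lemma omegaOp_one_apply (X : IntArray) : omegaOp 1 X 1 1 = X 2 1 + X 2 2 - X 1 1 := by
  simp [omegaOp_succ_apply X (m := 0) le_rfl le_rfl]

lemma omegaOp_diag (X : IntArray) {m : ℕ} (hm : 1 ≤ m) :
    omegaOp (m + 1) X (m + 1) (m + 1) =
      max (X (m + 2) (m + 1)) (omegaOp m X m m) + X (m + 2) (m + 2) - X (m + 1) (m + 1) := by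
  rw [omegaOp_succ_apply X (by omega) le_rfl, if_pos (by omega), if_neg (by omega)]
  simp

lemma omegaOp_two_one (X : IntArray) :
    omegaOp 2 X 2 1 = X 3 1 + min (X 3 2) (omegaOp 1 X 1 1) - X 2 1 := by
  simp [omegaOp_succ_apply X (m := 1) (j := 1) le_rfl (by omega)]

/-- In the recursion `omegaOp_diag`, bound the maximum by its first argument at step `i` and by its
second at every later step; the differences of corners telescope. -/
lemma le_omegaOp_diag (X : IntArray) {i m : ℕ} (hi : 1 ≤ i) (him : i ≤ m) :
    X (m + 1) (m + 1) - X i i + X (i + 1) i ≤ omegaOp m X m m := by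
  induction m, him using Nat.le_induction with
  | base =>
    rcases Nat.lt_or_ge 1 i with h | h
    · obtain ⟨k, rfl⟩ := Nat.exists_eq_add_of_le' h.le
      rw [omegaOp_diag X (by omega)]
      simp only [Nat.add_assoc, Nat.reduceAdd]
      linarith [le_max_left (X (k + 2) (k + 1)) (omegaOp k X k k)]
    · obtain rfl : i = 1 := by omega
      rw [omegaOp_one_apply]
      simp only [Nat.reduceAdd]
      omega
  | succ m hm ih =>
    rw [omegaOp_diag X (by omega)]
    simp only [Nat.add_assoc, Nat.reduceAdd]
    linarith [le_max_right (X (m + 2) (m + 1)) (omegaOp m X m m)]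

lemma schutzenberger_top (n : ℕ) (hn : 1 ≤ n) (X : IntArray) (j : ℕ) :
    schutzenberger n X n j = X n j :=
  omegaProd_of_lt X (by omega)

/-- The factors applied after the first one only change lower rows. -/
lemma schutzenberger_pred (n : ℕ) (X : IntArray) (j : ℕ) :
    schutzenberger (n + 2) X (n + 1) j = omegaOp (n + 1) X (n + 1) j :=
  omegaProd_of_lt (m := n) _ n.lt_succ_self

lemma schutzenberger_pred_pred (n : ℕ) (X : IntArray) (j : ℕ) :
    schutzenberger (n + 3) X (n + 1) j = omegaOp (n + 1) (omegaOp (n + 2) X) (n + 1) j :=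
  omegaProd_of_lt (m := n) _ n.lt_succ_self

lemma schutzenberger_pred_pred_pred (n : ℕ) (X : IntArray) (j : ℕ) :
    schutzenberger (n + 4) X (n + 1) j =
      omegaOp (n + 1) (omegaOp (n + 2) (omegaOp (n + 3) X)) (n + 1) j :=
  omegaProd_of_lt (m := n) _ n.lt_succ_self

/-! ### Triangles of size 3 -/

lemma isGelfandTsetlin_triangle3 {a d f b e c : ℤ} :
    IsGelfandTsetlin 3 (triangle3 a d f b e c) ↔
      0 < a ∧ a ≤ b ∧ b ≤ d ∧ d ≤ e ∧ e ≤ f ∧ b ≤ c ∧ c ≤ e := by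
  constructor
  · rintro ⟨hpos, -, hint⟩
    have h1 := hpos 3 1 (by omega) (by omega) (by omega)
    have h2 := hint 2 1 (by omega) (by omega) (by omega)
    have h3 := hint 2 2 (by omega) (by omega) (by omega)
    have h4 := hint 1 1 (by omega) (by omega) (by omega)
    simp only [triangle3] at h1 h2 h3 h4
    omega
  · rintro ⟨h1, h2, h3, h4, h5, h6, h7⟩
    refine ⟨fun i j h1 h2 h3 => ?_, fun i j h => ?_, fun i j h1 h2 h3 => ?_⟩
    · interval_cases i <;> interval_cases j <;> simp only [triangle3] <;> omega
    · unfold triangle3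
      split <;> first | rfl | exact absurd (by omega) h
    · have : i ≤ 2 := by omega
      interval_cases i <;> interval_cases j <;> simp only [triangle3] <;> omega

lemma IsGelfandTsetlin.eq_triangle3 {X : IntArray} (hX : IsGelfandTsetlin 3 X) :
    X = triangle3 (X 3 1) (X 3 2) (X 3 3) (X 2 1) (X 2 2) (X 1 1) := by
  funext i j
  by_cases h : 1 ≤ j ∧ j ≤ i ∧ i ≤ 3
  · obtain ⟨h1, h2, h3⟩ := h
    interval_cases i <;> interval_cases j <;> rfl
  · rw [hX.2.1 i j h]
    unfold triangle3
    split <;> first | rfl | exact absurd (by omega) h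

lemma triangle3_inj {a d f b e c a' d' f' b' e' c' : ℤ} :
    triangle3 a d f b e c = triangle3 a' d' f' b' e' c' ↔
      a = a' ∧ d = d' ∧ f = f' ∧ b = b' ∧ e = e' ∧ c = c' := by
  constructor
  · intro h
    exact ⟨congr_fun₂ h 3 1, congr_fun₂ h 3 2, congr_fun₂ h 3 3, congr_fun₂ h 2 1,
      congr_fun₂ h 2 2, congr_fun₂ h 1 1⟩
  · rintro ⟨rfl, rfl, rfl, rfl, rfl, rfl⟩
    rfl

lemma isInversion_triangle3_two_one {a d f b e c : ℤ} :
    IsInversion 3 (triangle3 a d f b e c) 2 1 ↔ b = a := by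
  simp [IsInversion, triangle3]

lemma isInversion_triangle3_two_two {a d f b e c : ℤ} :
    IsInversion 3 (triangle3 a d f b e c) 2 2 ↔ e = d := by
  simp [IsInversion, triangle3]

lemma isInversion_triangle3_one_one {a d f b e c : ℤ} :
    IsInversion 3 (triangle3 a d f b e c) 1 1 ↔ c = b := by
  simp [IsInversion, triangle3]

lemma pentagonTable_triangle3 (a d f b e c : ℤ) :
    pentagonTable (triangle3 a d f b e c) =
      if b = a then
        if e = d then
          if c = b then triangle3 a (d - 1) (f - 2) a (d - 1) a
          else triangle3 a (d - 1) (f - 1) a d c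
        else if c = b then triangle3 a (d - 1) (f - 1) a (e - 1) a
        else triangle3 a (d - 1) f a e c
      else
        if e = d then
          if c = b then triangle3 a (d - 1) (f - 2) a (d - 1) b
          else triangle3 a d (f - 1) b d c
        else if c = b then triangle3 a d (f - 1) b (e - 1) b
        else triangle3 a d f b e c := by
  by_cases h3 : c = b <;> by_cases h1 : b = a <;> by_cases h2 : e = d <;>
    simp only [pentagonTable, isInversion_triangle3_two_one, isInversion_triangle3_two_two,
      isInversion_triangle3_one_one] <;>
    split_ifs <;> simp_all [triangle3]

lemma inversionList_triangle3 (a d f b e c : ℤ) :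
    inversionList 3 (triangle3 a d f b e c) =
      (if e = d then [(2, 2)] else []) ++ (if b = a then [(2, 1)] else []) ++
        (if c = b then [(1, 1)] else []) := by
  by_cases h1 : b = a <;> by_cases h2 : e = d <;> by_cases h3 : c = b <;>
    simp [inversionList, List.range_succ, IsInversion, triangle3, List.filter] <;> simp_all

lemma covers_three_iff {p q : ℕ × ℕ} :
    Covers 3 p q ↔ p.1 < q.1 ∧ q.1 ≤ 3 ∧ q.1 + p.2 = p.1 + q.2 := by
  constructor
  · rintro ⟨t, h1, h2, rfl⟩
    simp only
    omega
  · rintro ⟨h1, h2, h3⟩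
    exact ⟨q.1 - p.1, by omega, by omega, Prod.ext (by simp only; omega) (by simp only; omega)⟩

lemma subtractCovered_two_two (a d f b e c : ℤ) :
    subtractCovered 3 (triangle3 a d f b e c) (2, 2) = triangle3 a d (f - 1) b e c := by
  funext i j
  simp only [subtractCovered, covers_three_iff]
  split_ifs with h
  · obtain ⟨rfl, rfl⟩ : i = 3 ∧ j = 3 := by omega
    rfl
  · unfold triangle3
    split <;> first | rfl | exact absurd (by omega) h

lemma subtractCovered_two_one (a d f b e c : ℤ) :
    subtractCovered 3 (triangle3 a d f b e c) (2, 1) = triangle3 a (d - 1) f b e c := by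
  funext i j
  simp only [subtractCovered, covers_three_iff]
  split_ifs with h
  · obtain ⟨rfl, rfl⟩ : i = 3 ∧ j = 2 := by omega
    rfl
  · unfold triangle3
    split <;> first | rfl | exact absurd (by omega) h

lemma subtractCovered_one_one (a d f b e c : ℤ) :
    subtractCovered 3 (triangle3 a d f b e c) (1, 1) = triangle3 a d (f - 1) b (e - 1) c := by
  funext i j
  simp only [subtractCovered, covers_three_iff]
  split_ifs with h
  · obtain ⟨rfl, rfl⟩ | ⟨rfl, rfl⟩ : (i = 3 ∧ j = 3) ∨ (i = 2 ∧ j = 2) := by omega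
    · rfl
    · rfl
  · unfold triangle3
    split <;> first | rfl | exact absurd (by omega) h

/-! ### Bottom three rows of Gog triangles -/

lemma pentagonPart_three (n : ℕ) (hn : 3 ≤ n) (X : IntArray) :
    pentagonPart n 3 3 3 X = triangle3 (X 3 1) (X 3 2) (X 3 3) (X 2 1) (X 2 2) (X 1 1) := by
  funext i j
  by_cases h : 1 ≤ j ∧ j ≤ i ∧ i ≤ 3
  · rw [pentagonPart, if_pos (by omega)]
    obtain ⟨h1, h2, h3⟩ := h
    interval_cases i <;> interval_cases j <;> rfl
  · rw [pentagonPart, if_neg (by omega)]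
    unfold triangle3
    split <;> first | rfl | exact absurd (by omega) h

lemma IsGelfandTsetlin.bottom_three {n : ℕ} (hn : 3 ≤ n) {X : IntArray}
    (hX : IsGelfandTsetlin n X) :
    0 < X 3 1 ∧ X 3 1 ≤ X 2 1 ∧ X 2 1 ≤ X 3 2 ∧ X 3 2 ≤ X 2 2 ∧ X 2 2 ≤ X 3 3 ∧
      X 2 1 ≤ X 1 1 ∧ X 1 1 ≤ X 2 2 := by
  obtain ⟨hpos, -, hint⟩ := hX
  have h1 := hpos 3 1 (by omega) (by omega) (by omega)
  have h2 := hint 2 1 (by omega) (by omega) (by omega)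
  have h3 := hint 2 2 (by omega) (by omega) (by omega)
  have h4 := hint 1 1 (by omega) (by omega) (by omega)
  simp only [Nat.reduceAdd] at h2 h3 h4
  omega

/-! ### Extending a size-3 triangle to size `n` -/

section extensions

/-- The triangle of size `n` with bottom rows `(a,d,f|b,e|c)` and the smallest possible rows above
whose `j`-th entries are at least `g j`. -/
def extendTriangle3 (n : ℕ) (g : ℕ → ℤ) (a d f b e c : ℤ) : IntArray := fun i j =>
  if 1 ≤ j ∧ j ≤ i ∧ i ≤ n then
    if i ≤ 3 then triangle3 a d f b e c i j
    else if j = i then max (g j) f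
    else if j + 1 = i then max (g j) d
    else if j + 2 = i then max (g j) a
    else g j
  else 0

variable {n : ℕ} {g : ℕ → ℤ} {a d f b e c : ℤ}

lemma extendTriangle3_of_le {i j : ℕ} (hin : i ≤ n) (h1 : 1 ≤ j) (hj : j ≤ i) (hi : i ≤ 3) :
    extendTriangle3 n g a d f b e c i j = triangle3 a d f b e c i j := by
  rw [extendTriangle3, if_pos ⟨h1, hj, hin⟩, if_pos hi]

/-- Since `g` lies below row 3, that row obeys the formula of the higher rows too, and the passage
from row 3 to row 4 needs no separate treatment. -/
lemma extendTriangle3_of_ge (ha : g 1 ≤ a) (hd : g 2 ≤ d) (hf : g 3 ≤ f) {i j : ℕ} (hi : 3 ≤ i)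
    (hin : i ≤ n) (h1 : 1 ≤ j) (hj : j ≤ i) :
    extendTriangle3 n g a d f b e c i j =
      if j = i then max (g j) f
      else if j + 1 = i then max (g j) d
      else if j + 2 = i then max (g j) a
      else g j := by
  rcases hi.eq_or_lt with rfl | hi
  · rw [extendTriangle3_of_le hin h1 hj le_rfl]
    interval_cases j <;> simp [triangle3, ha, hd, hf]
  · rw [extendTriangle3, if_pos ⟨h1, hj, hin⟩, if_neg (by omega)]

lemma isGelfandTsetlin_extendTriangle3 (h : IsGelfandTsetlin 3 (triangle3 a d f b e c))
    (hpos : ∀ j, 0 < g j) (hmono : ∀ j, g j ≤ g (j + 1))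
    (ha : g 1 ≤ a) (hd : g 2 ≤ d) (hf : g 3 ≤ f) :
    IsGelfandTsetlin n (extendTriangle3 n g a d f b e c) := by
  have h' := isGelfandTsetlin_triangle3.1 h
  refine ⟨fun i j h1 h2 h3 => ?_, fun i j h => if_neg h, fun i j h1 h2 h3 => ?_⟩
  · rcases le_total i 3 with hi | hi
    · rw [extendTriangle3_of_le h3 h1 h2 hi]
      exact h.1 i j h1 h2 hi
    · rw [extendTriangle3_of_ge ha hd hf hi h3 h1 h2]
      have := hpos j
      split_ifs <;> omega
  · rcases Nat.lt_or_ge i 3 with hi | hi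
    · rw [extendTriangle3_of_le h3 h1 (by omega) hi, extendTriangle3_of_le (by omega) h1 h2 hi.le,
        extendTriangle3_of_le h3 (by omega) (by omega) hi]
      exact h.2.2 i j h1 h2 hi
    · rw [extendTriangle3_of_ge ha hd hf (by omega) h3 h1 (by omega),
        extendTriangle3_of_ge ha hd hf hi (by omega) h1 h2,
        extendTriangle3_of_ge ha hd hf (by omega) h3 (by omega) (by omega)]
      have e1 := hmono j
      have e2 : j = 2 → g j ≤ d := fun hj => hj ▸ hd
      have e3 : j = 1 → g j ≤ a := fun hj => hj ▸ ha
      split_ifs <;> omega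

lemma pentagonPart_extendTriangle3 (hn : 3 ≤ n) :
    pentagonPart n 3 3 3 (extendTriangle3 n g a d f b e c) = triangle3 a d f b e c := by
  rw [pentagonPart_three n hn, triangle3_inj]
  refine ⟨?_, ?_, ?_, ?_, ?_, ?_⟩ <;>
    exact extendTriangle3_of_le (by omega) (by omega) (by omega) (by omega)

/-- The top row becomes `(1, …, n)` because `a ≤ n - 2`, `d ≤ n - 1`, `f ≤ n`. The maximum with 1
only makes `g 0` positive. -/
lemma isGog_extendTriangle3 (hn : 3 ≤ n) (h : IsGelfandTsetlin 3 (triangle3 a d f b e c))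
    (had : a < d) (hdf : d < f) (hbe : b < e) (hf : f ≤ n) :
    IsGog n (extendTriangle3 n (fun j => max 1 (j : ℤ)) a d f b e c) := by
  have h' := isGelfandTsetlin_triangle3.1 h
  have ha1 : max 1 ((1 : ℕ) : ℤ) ≤ a := by push_cast; omega
  have hd1 : max 1 ((2 : ℕ) : ℤ) ≤ d := by push_cast; omega
  have hf1 : max 1 ((3 : ℕ) : ℤ) ≤ f := by push_cast; omega
  have hhigh {i j : ℕ} (hi : 3 ≤ i) (hin : i ≤ n) (h1 : 1 ≤ j) (hj : j ≤ i) :=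
    extendTriangle3_of_ge (g := fun j : ℕ => max 1 (j : ℤ)) (b := b) (e := e) (c := c)
      ha1 hd1 hf1 hi hin h1 hj
  refine ⟨isGelfandTsetlin_extendTriangle3 h (fun j => by omega) (fun j => by push_cast; omega)
    ha1 hd1 hf1, fun i j h1 h2 h3 => ?_, fun j h1 h2 => ?_⟩
  · rcases Nat.lt_or_ge i 3 with hi | hi
    · rw [extendTriangle3_of_le h3.le h1 h2.le hi.le,
        extendTriangle3_of_le h3.le (by omega) h2 hi.le]
      obtain rfl : i = 2 := by omega
      obtain rfl : j = 1 := by omega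
      exact hbe
    · rw [hhigh hi h3.le h1 h2.le, hhigh hi h3.le (by omega) h2]
      push_cast
      split_ifs <;> omega
  · rw [hhigh hn le_rfl h1 h2]
    split_ifs <;> omega

end extensions

lemma mem_gogPentagons_three_iff {n : ℕ} (hn : 3 ≤ n) (X : IntArray) :
    X ∈ gogPentagons n 3 3 3 ↔ IsGelfandTsetlin 3 X ∧
      X 3 1 < X 3 2 ∧ X 3 2 < X 3 3 ∧ X 2 1 < X 2 2 ∧ X 3 3 ≤ (n : ℤ) := by
  constructor
  · rintro ⟨Y, ⟨hY, hlt, htop⟩, rfl⟩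
    rw [pentagonPart_three n hn, isGelfandTsetlin_triangle3]
    refine ⟨hY.bottom_three hn, ?_⟩
    have h1 := hlt 2 1 (by omega) (by omega) (by omega)
    have h2 := hY.diag_mono (by omega) hn le_rfl
    rw [htop n (by omega) le_rfl] at h2
    simp only [triangle3]
    -- For `n = 3`, row 3 is the top row: its strict increase comes from its prescribed values.
    rcases hn.eq_or_lt with rfl | h
    · have e1 := htop 1 (by omega) (by omega)
      have e2 := htop 2 (by omega) (by omega)
      have e3 := htop 3 (by omega) (by omega)
      push_cast at e1 e2 e3 h2
      simp only [Nat.reduceAdd] at h1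
      push_cast
      omega
    · have e1 := hlt 3 1 (by omega) (by omega) h
      have e2 := hlt 3 2 (by omega) (by omega) h
      simp only [Nat.reduceAdd] at e1 e2 h1
      omega
  · rintro ⟨hX, h1, h2, h3, h4⟩
    have hX' := hX.eq_triangle3
    rw [hX'] at hX
    exact ⟨_, isGog_extendTriangle3 hn hX h1 h2 h3 h4,
      (pentagonPart_extendTriangle3 hn).trans hX'.symm⟩

/-! ### Bottom three rows of GOGAm triangles -/

/-- If the rows `3, …, m + 1` of `X` are `(1, …, 1, a, d, f)`, then the rows `2, …, m` of `ω_m X`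
are `(1, …, 1, q, p)`. -/
lemma omegaOp_of_three_diagonals {X : IntArray} {m : ℕ} {a d f : ℤ}
    (hX : ∀ i j, 3 ≤ i → i ≤ m + 1 → 1 ≤ j → j ≤ i →
      X i j = if j = i then f else if j + 1 = i then d else if j + 2 = i then a else 1)
    (h : IsGelfandTsetlin 3 (triangle3 a d f (X 2 1) (X 2 2) (X 1 1))) {i j : ℕ} (hi : 2 ≤ i)
    (him : i ≤ m) (h1 : 1 ≤ j) (hj : j ≤ i) :
    omegaOp m X i j =
      if j = i then max d (X 2 1 + X 2 2 - X 1 1) + f - X 2 2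
      else if j + 1 = i then a + min d (X 2 1 + X 2 2 - X 1 1) - X 2 1
      else 1 := by
  have h' := isGelfandTsetlin_triangle3.1 h
  rw [omegaOp_of_le X him]
  induction i, hi using Nat.le_induction generalizing j with
  | base =>
    have e1 := hX 3 1 le_rfl (by omega) le_rfl (by omega)
    have e2 := hX 3 2 le_rfl (by omega) (by omega) (by omega)
    have e3 := hX 3 3 le_rfl (by omega) (by omega) le_rfl
    obtain rfl | rfl : j = 1 ∨ j = 2 := by omega
    · rw [omegaOp_two_one, omegaOp_one_apply, e1, e2]
      rfl
    · rw [omegaOp_diag X le_rfl, omegaOp_one_apply, e2, e3]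
      rfl
  -- Write `p`, `q` for the last two values. From `d ≤ p` and `a ≤ q` the corner is `max d p + f - f
  -- = p`, the next entry `max a q + d - d = q`, and the third `1 + a - a = 1`.
  | succ i hi ih =>
    rw [omegaOp_succ_apply X h1 hj, hX _ _ (by omega) (by omega) h1 (by omega),
      hX _ _ (by omega) (by omega) h1 hj, hX _ _ (by omega) (by omega) (by omega) (by omega)]
    have e1 (h : j < i + 1) := ih (by omega) h1 (Nat.le_of_lt_succ h)
    have e2 (h : 1 < j) := ih (j := j - 1) (by omega) (by omega) (by omega)
    rcases Nat.lt_or_ge 1 j with c1 | c1 <;> rcases Nat.lt_or_ge j (i + 1) with c2 | c2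
    · rw [if_pos c1, if_pos c2, e1 c2, e2 c1]
      clear ih hX e1 e2
      obtain c3 | c3 | c3 : j = i ∨ j + 1 = i ∨ j + 1 < i := (by omega) <;>
        simp (disch := omega) only [if_pos, if_neg] <;> omega
    · rw [if_pos c1, if_neg (by omega), e2 c1]
      clear ih hX e1 e2
      simp (disch := omega) only [if_pos, if_neg]
      omega
    · rw [if_neg (by omega), if_pos c2, e1 c2]
      clear ih hX e1 e2
      obtain c3 | c3 | c3 : j = i ∨ j + 1 = i ∨ j + 1 < i := (by omega) <;>
        simp (disch := omega) only [if_pos, if_neg] <;> omega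
    · omega

/-- If the rows `2, …, m + 1` of `X` are `(1, …, 1, q, p)`, then the rows `1, …, m` of `ω_m X`
are `(1, …, 1, r)`. -/
lemma omegaOp_of_two_diagonals {X : IntArray} {m : ℕ} {q p : ℤ}
    (hX : ∀ i j, 2 ≤ i → i ≤ m + 1 → 1 ≤ j → j ≤ i →
      X i j = if j = i then p else if j + 1 = i then q else 1)
    (hqp : 1 ≤ q ∧ q ≤ X 1 1 ∧ X 1 1 ≤ p) {i j : ℕ} (hi : 1 ≤ i)
    (him : i ≤ m) (h1 : 1 ≤ j) (hj : j ≤ i) :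
    omegaOp m X i j = if j = i then q + p - X 1 1 else 1 := by
  rw [omegaOp_of_le X him]
  induction i, hi using Nat.le_induction generalizing j with
  | base =>
    have e1 := hX 2 1 le_rfl (by omega) le_rfl (by omega)
    have e2 := hX 2 2 le_rfl (by omega) (by omega) le_rfl
    obtain rfl : j = 1 := by omega
    rw [omegaOp_one_apply, e1, e2]
    rfl
  -- With `r = q + p - X 1 1 ≥ q`, the corner is `max q r + p - p = r` and its neighbour `1 + q - q
  -- = 1`.
  | succ i hi ih =>
    rw [omegaOp_succ_apply X h1 hj, hX _ _ (by omega) (by omega) h1 (by omega),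
      hX _ _ (by omega) (by omega) h1 hj, hX _ _ (by omega) (by omega) (by omega) (by omega)]
    have e1 (h : j < i + 1) := ih (by omega) h1 (Nat.le_of_lt_succ h)
    have e2 (h : 1 < j) := ih (j := j - 1) (by omega) (by omega) (by omega)
    rcases Nat.lt_or_ge 1 j with c1 | c1 <;> rcases Nat.lt_or_ge j (i + 1) with c2 | c2
    · rw [if_pos c1, if_pos c2, e1 c2, e2 c1]
      clear ih hX e1 e2
      obtain c3 | c3 : j = i ∨ j < i := (by omega) <;>
        simp (disch := omega) only [if_pos, if_neg] <;> omega
    · rw [if_pos c1, if_neg (by omega), e2 c1]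
      clear ih hX e1 e2
      simp (disch := omega) only [if_pos, if_neg]
      omega
    · rw [if_neg (by omega), if_pos c2, e1 c2]
      clear ih hX e1 e2
      obtain c3 | c3 : j = i ∨ j < i := (by omega) <;>
        simp (disch := omega) only [if_pos, if_neg] <;> omega
    · omega

/-- If the rows `1, …, m + 1` of `X` are `(1, …, 1, r)`, then the last diagonal of `ω_m X`
is `(1, …, 1)`. -/
lemma omegaOp_diag_of_one_diagonal {X : IntArray} {m : ℕ} {r : ℤ}
    (hX : ∀ i j, 1 ≤ i → i ≤ m + 1 → 1 ≤ j → j ≤ i → X i j = if j = i then r else 1)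
    (hm : 1 ≤ m) : omegaOp m X m m = 1 := by
  induction m, hm using Nat.le_induction with
  | base =>
    rw [omegaOp_one_apply, hX 2 1 (by omega) (by omega) le_rfl (by omega),
      hX 2 2 (by omega) (by omega) (by omega) le_rfl, hX 1 1 (by omega) (by omega) le_rfl le_rfl,
      if_neg (by omega), if_pos rfl, if_pos rfl]
    omega
  | succ m hm ih =>
    rw [omegaOp_diag X hm, ih fun i j h1 h2 => hX i j h1 (by omega),
      hX _ _ (by omega) (by omega) (by omega) (by omega),
      hX _ _ (by omega) (by omega) (by omega) (by omega),
      hX _ _ (by omega) (by omega) (by omega) (by omega),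
      if_neg (by omega), if_pos rfl, if_pos rfl]
    omega

lemma isMagog_schutzenberger_of_three_diagonals {n : ℕ} (hn : 3 ≤ n) {X : IntArray} {a d f : ℤ}
    (hGT : IsGelfandTsetlin n X)
    (hX : ∀ i j, 3 ≤ i → i ≤ n → 1 ≤ j → j ≤ i →
      X i j = if j = i then f else if j + 1 = i then d else if j + 2 = i then a else 1)
    (h : IsGelfandTsetlin 3 (triangle3 a d f (X 2 1) (X 2 2) (X 1 1)))
    (h1 : f ≤ n) (h2 : f - X 2 2 + d ≤ n - 1) (h3 : f - X 1 1 + X 2 1 ≤ n - 1)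
    (h4 : f - X 2 2 + d - X 2 1 + a ≤ n - 2) : IsMagog n (schutzenberger n X) := by
  have h' := isGelfandTsetlin_triangle3.1 h
  have hS : IsGelfandTsetlin n (schutzenberger n X) := hGT.omegaProd (by omega)
  refine ⟨hS, fun j hj hjn => ?_⟩
  obtain ⟨m, rfl⟩ := Nat.exists_eq_add_of_le' hn
  push_cast at h1 h2 h3 h4
  have hY (i j : ℕ) (h2 : 2 ≤ i) (h3 : i ≤ m + 1 + 1) :=
    omegaOp_of_three_diagonals (m := m + 2) (j := j) hX h h2 h3
  have y11 : omegaOp (m + 2) X 1 1 = X 2 1 + X 2 2 - X 1 1 := by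
    rw [omegaOp_of_le X (by omega), omegaOp_one_apply]
  have hZ (i j : ℕ) (h1 : 1 ≤ i) (h2 : i ≤ m + 1) :=
    omegaOp_of_two_diagonals (m := m + 1) (j := j) hY (by omega) h1 h2
  rcases Nat.lt_or_ge j (m + 1) with hj1 | hj1
  -- Corners increase upwards and the one in row `n - 3` is 1.
  · obtain ⟨k, rfl⟩ := Nat.exists_eq_add_of_le' (hj.trans (Nat.le_of_lt_succ hj1))
    have e := hS.diag_mono hj (Nat.le_of_lt_succ hj1) (by omega)
    rw [schutzenberger_pred_pred_pred k X, omegaOp_diag_of_one_diagonal hZ (by omega)] at e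
    omega
  · obtain rfl | rfl | rfl : j = m + 1 ∨ j = m + 2 ∨ j = m + 3 := by omega
    · rw [schutzenberger_pred_pred, hZ _ _ (by omega) le_rfl (by omega) le_rfl, if_pos rfl, y11]
      push_cast
      omega
    · rw [schutzenberger_pred (m + 1), hY _ _ (by omega) le_rfl (by omega) le_rfl, if_pos rfl]
      push_cast
      omega
    · rw [schutzenberger_top _ (by omega), hX _ _ (by omega) le_rfl (by omega) le_rfl, if_pos rfl]
      push_cast
      omega

lemma mem_gogamPentagons_three_of {n : ℕ} (hn : 3 ≤ n) {a d f b e c : ℤ}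
    (h : IsGelfandTsetlin 3 (triangle3 a d f b e c)) (h1 : f ≤ n) (h2 : f - e + d ≤ n - 1)
    (h3 : f - c + b ≤ n - 1) (h4 : f - e + d - b + a ≤ n - 2) :
    triangle3 a d f b e c ∈ gogamPentagons n 3 3 3 := by
  have h' := isGelfandTsetlin_triangle3.1 h
  have ha1 : (1 : ℤ) ≤ a := by omega
  have hd1 : (1 : ℤ) ≤ d := by omega
  have hf1 : (1 : ℤ) ≤ f := by omega
  have hX : IsGelfandTsetlin n (extendTriangle3 n (fun _ => 1) a d f b e c) :=
    isGelfandTsetlin_extendTriangle3 h (fun _ => one_pos) (fun _ => le_rfl) ha1 hd1 hf1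
  have hlow {i j : ℕ} (h1 : 1 ≤ j) (hj : j ≤ i) (hi : i ≤ 3) :=
    extendTriangle3_of_le (n := n) (g := fun _ => 1) (a := a) (d := d) (f := f) (b := b) (e := e)
      (c := c) (hi.trans hn) h1 hj hi
  have x11 := hlow (i := 1) (j := 1) (by omega) (by omega) (by omega)
  have x21 := hlow (i := 2) (j := 1) (by omega) (by omega) (by omega)
  have x22 := hlow (i := 2) (j := 2) (by omega) (by omega) (by omega)
  simp only [triangle3] at x11 x21 x22
  refine ⟨_, ⟨hX, isMagog_schutzenberger_of_three_diagonals hn (a := a) (d := d) (f := f) hX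
    (fun i j hi hin h1 hj => ?_) ?_ h1 ?_ ?_ ?_⟩, pentagonPart_extendTriangle3 hn⟩
  · rw [extendTriangle3_of_ge (g := fun _ => 1) ha1 hd1 hf1 hi hin h1 hj, max_eq_right ha1,
      max_eq_right hd1, max_eq_right hf1]
  · rwa [x11, x21, x22]
  · rwa [x22]
  · rwa [x11, x21]
  · rwa [x21, x22]

lemma mem_gogamPentagons_three_iff {n : ℕ} (hn : 3 ≤ n) (X : IntArray) :
    X ∈ gogamPentagons n 3 3 3 ↔ IsGelfandTsetlin 3 X ∧ X 3 3 ≤ (n : ℤ) ∧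
      X 3 3 - X 2 2 + X 3 2 ≤ (n : ℤ) - 1 ∧ X 3 3 - X 1 1 + X 2 1 ≤ (n : ℤ) - 1 ∧
      X 3 3 - X 2 2 + X 3 2 - X 2 1 + X 3 1 ≤ (n : ℤ) - 2 := by
  constructor
  · rintro ⟨Y, ⟨hY, -, hM⟩, rfl⟩
    rw [pentagonPart_three n hn, isGelfandTsetlin_triangle3]
    refine ⟨hY.bottom_three hn, ?_⟩
    have h0 := hY.bottom_three hn
    have h1 := hM n (by omega) le_rfl
    have h2 := hY.diag_mono (by omega) hn le_rfl
    obtain ⟨m, rfl⟩ := Nat.exists_eq_add_of_le' hn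
    have h3 := hM (m + 2) (by omega) (by omega)
    have h4 := hM (m + 1) (by omega) (by omega)
    rw [schutzenberger_top _ (by omega)] at h1
    rw [schutzenberger_pred (m + 1)] at h3
    rw [schutzenberger_pred_pred] at h4
    have e1 := le_omegaOp_diag Y (i := 1) (m := m + 2) (by omega) (by omega)
    have e2 := le_omegaOp_diag Y (i := 2) (m := m + 2) (by omega) (by omega)
    -- `e1` and `e2` together bound the corner of row `n - 1` below by a maximum; `e3` adds the
    -- matching minimum inside `omegaOp 2 Y 2 1`. As max plus min is the sum, `c` cancels and `f - e
    -- + d - b + a` remains.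
    have e3 := le_omegaOp_diag (omegaOp (m + 2) Y) (i := 1) (m := m + 1) le_rfl (by omega)
    rw [omegaOp_of_le Y (show 1 ≤ m + 2 by omega), omegaOp_of_le Y (show 1 + 1 ≤ m + 2 by omega),
      omegaOp_one_apply, omegaOp_two_one, omegaOp_one_apply] at e3
    simp only [Nat.add_assoc, Nat.reduceAdd] at h1 h2 h3 h4 e1 e2 e3
    push_cast at h1 h3 h4 ⊢
    simp only [triangle3]
    omega
  · rintro ⟨hX, h1, h2, h3, h4⟩
    have hX' := hX.eq_triangle3
    rw [hX'] at hX
    rw [hX']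
    exact mem_gogamPentagons_three_of hn hX h1 h2 h3 h4

/-! ### The table -/

lemma triangle3_mem_gogPentagons {n : ℕ} (hn : 3 ≤ n) {a d f b e c : ℤ} :
    triangle3 a d f b e c ∈ gogPentagons n 3 3 3 ↔
      (0 < a ∧ a ≤ b ∧ b ≤ d ∧ d ≤ e ∧ e ≤ f ∧ b ≤ c ∧ c ≤ e) ∧
        a < d ∧ d < f ∧ b < e ∧ f ≤ n := by
  rw [mem_gogPentagons_three_iff hn, isGelfandTsetlin_triangle3]
  rfl

lemma triangle3_mem_gogamPentagons {n : ℕ} (hn : 3 ≤ n) {a d f b e c : ℤ} :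
    triangle3 a d f b e c ∈ gogamPentagons n 3 3 3 ↔
      (0 < a ∧ a ≤ b ∧ b ≤ d ∧ d ≤ e ∧ e ≤ f ∧ b ≤ c ∧ c ≤ e) ∧
        f ≤ n ∧ f - e + d ≤ n - 1 ∧ f - c + b ≤ n - 1 ∧ f - e + d - b + a ≤ n - 2 := by
  rw [mem_gogamPentagons_three_iff hn, isGelfandTsetlin_triangle3]
  rfl

lemma exists_triangle3_of_mem_gogPentagons {n : ℕ} (hn : 3 ≤ n) {X : IntArray}
    (hX : X ∈ gogPentagons n 3 3 3) : ∃ a d f b e c, X = triangle3 a d f b e c :=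
  ⟨_, _, _, _, _, _, ((mem_gogPentagons_three_iff hn X).1 hX).1.eq_triangle3⟩

lemma exists_triangle3_of_mem_gogamPentagons {n : ℕ} (hn : 3 ≤ n) {X : IntArray}
    (hX : X ∈ gogamPentagons n 3 3 3) : ∃ a d f b e c, X = triangle3 a d f b e c :=
  ⟨_, _, _, _, _, _, ((mem_gogamPentagons_three_iff hn X).1 hX).1.eq_triangle3⟩

lemma mapsTo_pentagonTable {n : ℕ} (hn : 3 ≤ n) :
    Set.MapsTo pentagonTable (gogPentagons n 3 3 3) (gogamPentagons n 3 3 3) := by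
  intro X hX
  obtain ⟨a, d, f, b, e, c, rfl⟩ := exists_triangle3_of_mem_gogPentagons hn hX
  rw [triangle3_mem_gogPentagons hn] at hX
  rw [pentagonTable_triangle3]
  split_ifs <;> rw [triangle3_mem_gogamPentagons hn] <;> omega

lemma injOn_pentagonTable {n : ℕ} (hn : 3 ≤ n) :
    Set.InjOn pentagonTable (gogPentagons n 3 3 3) := by
  intro X hX Y hY h
  obtain ⟨a, d, f, b, e, c, rfl⟩ := exists_triangle3_of_mem_gogPentagons hn hX
  obtain ⟨a', d', f', b', e', c', rfl⟩ := exists_triangle3_of_mem_gogPentagons hn hY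
  rw [triangle3_mem_gogPentagons hn] at hX hY
  rw [pentagonTable_triangle3, pentagonTable_triangle3] at h
  rw [triangle3_inj]
  split_ifs at h <;> rw [triangle3_inj] at h <;> omega

/-- The equalities among the entries of the target select the table line, which is then inverted. -/
lemma surjOn_pentagonTable {n : ℕ} (hn : 3 ≤ n) :
    Set.SurjOn pentagonTable (gogPentagons n 3 3 3) (gogamPentagons n 3 3 3) := by
  intro P hP
  obtain ⟨a, d, f, b, e, c, rfl⟩ := exists_triangle3_of_mem_gogamPentagons hn hP
  rw [triangle3_mem_gogamPentagons hn] at hP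
  have key {a' d' f' b' e' c' : ℤ} (h : triangle3 a' d' f' b' e' c' ∈ gogPentagons n 3 3 3)
      (h' : pentagonTable (triangle3 a' d' f' b' e' c') = triangle3 a d f b e c) :
      triangle3 a d f b e c ∈ pentagonTable '' gogPentagons n 3 3 3 := ⟨_, h, h'⟩
  by_cases h1 : b = a <;> by_cases h2 : c = b <;> by_cases h3 : e = d
  · apply key (a' := a) (d' := d + 1) (f' := f + 2) (b' := a) (e' := d + 1) (c' := a)
    · rw [triangle3_mem_gogPentagons hn]; omega
    · rw [pentagonTable_triangle3]; split_ifs <;> rw [triangle3_inj] <;> omega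
  · apply key (a' := a) (d' := d + 1) (f' := f + 1) (b' := a) (e' := e + 1) (c' := a)
    · rw [triangle3_mem_gogPentagons hn]; omega
    · rw [pentagonTable_triangle3]; split_ifs <;> rw [triangle3_inj] <;> omega
  -- The exceptional line: the image replaces `b` by `a`, but its entry `c` still records the old
  -- `b`.
  · apply key (a' := a) (d' := d + 1) (f' := f + 2) (b' := c) (e' := d + 1) (c' := c)
    · rw [triangle3_mem_gogPentagons hn]; omega
    · rw [pentagonTable_triangle3]; split_ifs <;> rw [triangle3_inj] <;> omega
  -- Lowering only `d` leaves a gap of exactly 1 below `e` when `(2,2)` was an inversion, and at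
  -- least 2 otherwise.
  · by_cases h4 : e = d + 1
    · apply key (a' := a) (d' := d + 1) (f' := f + 1) (b' := a) (e' := d + 1) (c' := c)
      · rw [triangle3_mem_gogPentagons hn]; omega
      · rw [pentagonTable_triangle3]; split_ifs <;> rw [triangle3_inj] <;> omega
    · apply key (a' := a) (d' := d + 1) (f' := f) (b' := a) (e' := e) (c' := c)
      · rw [triangle3_mem_gogPentagons hn]; omega
      · rw [pentagonTable_triangle3]; split_ifs <;> rw [triangle3_inj] <;> omega
  · apply key (a' := a) (d' := d) (f' := f + 1) (b' := b) (e' := e + 1) (c' := b)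
    · rw [triangle3_mem_gogPentagons hn]; omega
    · rw [pentagonTable_triangle3]; split_ifs <;> rw [triangle3_inj] <;> omega
  · apply key (a' := a) (d' := d) (f' := f + 1) (b' := b) (e' := e + 1) (c' := b)
    · rw [triangle3_mem_gogPentagons hn]; omega
    · rw [pentagonTable_triangle3]; split_ifs <;> rw [triangle3_inj] <;> omega
  · apply key (a' := a) (d' := d) (f' := f + 1) (b' := b) (e' := d) (c' := c)
    · rw [triangle3_mem_gogPentagons hn]; omega
    · rw [pentagonTable_triangle3]; split_ifs <;> rw [triangle3_inj] <;> omega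
  · apply key (a' := a) (d' := d) (f' := f) (b' := b) (e' := e) (c' := c)
    · rw [triangle3_mem_gogPentagons hn]; omega
    · rw [pentagonTable_triangle3]; split_ifs <;> rw [triangle3_inj] <;> omega

lemma bijOn_pentagonTable {n : ℕ} (hn : 3 ≤ n) :
    Set.BijOn pentagonTable (gogPentagons n 3 3 3) (gogamPentagons n 3 3 3) :=
  ⟨mapsTo_pentagonTable hn, injOn_pentagonTable hn, surjOn_pentagonTable hn⟩

lemma finite_gogPentagons {n : ℕ} (hn : 3 ≤ n) : (gogPentagons n 3 3 3).Finite := by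
  have hI : (Set.Icc (0 : ℤ) n).Finite := Set.finite_Icc _ _
  refine ((hI.prod (hI.prod (hI.prod (hI.prod (hI.prod hI))))).image
    fun p => triangle3 p.1 p.2.1 p.2.2.1 p.2.2.2.1 p.2.2.2.2.1 p.2.2.2.2.2).subset ?_
  intro X hX
  obtain ⟨a, d, f, b, e, c, rfl⟩ := exists_triangle3_of_mem_gogPentagons hn hX
  rw [triangle3_mem_gogPentagons hn] at hX
  refine ⟨(a, d, f, b, e, c), ?_, rfl⟩
  simp only [Set.mem_prod, Set.mem_Icc]
  omega

/-- The strict Gog inequalities leave room for each subtraction. When all three inversions occur,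
`(2,1)` lowers `d` before `(1,1)` lowers `e`, so `d ≤ e` survives. -/
lemma admissible_triangle3 {n : ℕ} (hn : 3 ≤ n) {a d f b e c : ℤ}
    (hX : triangle3 a d f b e c ∈ gogPentagons n 3 3 3) (h : ¬ (c = b ∧ e = d ∧ ¬ b = a)) :
    Admissible 3 (triangle3 a d f b e c) ∧
      pentagonTable (triangle3 a d f b e c) = standardProcedure 3 (triangle3 a d f b e c) := by
  rw [triangle3_mem_gogPentagons hn] at hX
  rw [Admissible, standardProcedure, pentagonTable_triangle3, inversionList_triangle3]
  split_ifs <;>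
    simp only [List.nil_append, List.append_nil, List.cons_append, List.scanl_cons,
      List.scanl_nil, List.foldl_cons, List.foldl_nil, List.forall_mem_cons,
      List.not_mem_nil, false_implies, implies_true, subtractCovered_two_two, subtractCovered_two_one,
      subtractCovered_one_one, isGelfandTsetlin_triangle3, triangle3_inj, and_true, true_and] <;>
    omega

/-- Here `(1,1)` lowers `e = d` while nothing lowers `d`, which breaks `d ≤ e`. -/
lemma not_admissible_triangle3 {a d f b e c : ℤ} (h1 : c = b) (h2 : e = d) (h3 : ¬ b = a) :
    ¬ Admissible 3 (triangle3 a d f b e c) := by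
  rw [Admissible, inversionList_triangle3, if_pos h1, if_pos h2, if_neg h3]
  simp only [List.nil_append, List.append_nil, List.cons_append, List.scanl_cons,
    List.scanl_nil, List.forall_mem_cons, List.not_mem_nil, false_implies, implies_true, subtractCovered_two_two,
    subtractCovered_one_one, isGelfandTsetlin_triangle3]
  omega

end Pentagons

open Pentagons
theorem mainTheorem4 (n : ℕ) (hn : 3 ≤ n) :
    -- the `(n,3,3,3)` Gog pentagons
    (∀ X : IntArray, X ∈ gogPentagons n 3 3 3 ↔
      IsGelfandTsetlin 3 X ∧
        X 3 1 < X 3 2 ∧ X 3 2 < X 3 3 ∧ X 2 1 < X 2 2 ∧ X 3 3 ≤ (n : ℤ)) ∧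
    -- the `(n,3,3,3)` GOGAm pentagons
    (∀ X : IntArray, X ∈ gogamPentagons n 3 3 3 ↔
      IsGelfandTsetlin 3 X ∧
        X 3 3 ≤ (n : ℤ) ∧
        X 3 3 - X 2 2 + X 3 2 ≤ (n : ℤ) - 1 ∧
        X 3 3 - X 1 1 + X 2 1 ≤ (n : ℤ) - 1 ∧
        X 3 3 - X 2 2 + X 3 2 - X 2 1 + X 3 1 ≤ (n : ℤ) - 2) ∧
    -- the table is a bijection
    Set.BijOn pentagonTable (gogPentagons n 3 3 3) (gogamPentagons n 3 3 3) ∧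
    -- it is the standard procedure in seven cases, and in the remaining one that does not apply
    (∀ X ∈ gogPentagons n 3 3 3,
      (¬ (IsInversion 3 X 1 1 ∧ IsInversion 3 X 2 2 ∧ ¬ IsInversion 3 X 2 1) →
        Admissible 3 X ∧ pentagonTable X = standardProcedure 3 X) ∧
      (IsInversion 3 X 1 1 ∧ IsInversion 3 X 2 2 ∧ ¬ IsInversion 3 X 2 1 →
        ¬ Admissible 3 X)) ∧
    -- the pentagon conjecture for this shape
    (gogPentagons n 3 3 3).Finite ∧ (gogamPentagons n 3 3 3).Finite ∧
    (gogPentagons n 3 3 3).ncard = (gogamPentagons n 3 3 3).ncard := by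
  have hbij := bijOn_pentagonTable hn
  have hfin := finite_gogPentagons hn
  refine ⟨mem_gogPentagons_three_iff hn, mem_gogamPentagons_three_iff hn, hbij, fun X hX => ?_,
    hfin, hbij.image_eq ▸ hfin.image _, ?_⟩
  · obtain ⟨a, d, f, b, e, c, rfl⟩ := exists_triangle3_of_mem_gogPentagons hn hX
    rw [isInversion_triangle3_one_one, isInversion_triangle3_two_two,
      isInversion_triangle3_two_one]
    exact ⟨admissible_triangle3 hn hX, fun h => not_admissible_triangle3 h.1 h.2.1 h.2.2⟩
  · rw [← hbij.image_eq, hbij.injOn.ncard_image]
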